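/- Let $\mathbb R^\omega$ be the countable product of real lines with the product topology, and let $\omega^\omega$ be the countable product of copies of the discrete space $\omega=\{0,1,2,\dots\}$. Let $\mathrm{cov}(\mathcal M)$ denote the smallest cardinality of a cover of $\omega^\omega$ by nowhere dense subsets. A Borel subset $A$ of $\mathbb R^\omega$ is called Haar-meager if there is a continuous map $f:\{0,1\}^\omega\to\mathbb R^\omega$ from the Cantor cube such that for all $x,y\in\mathbb R^\omega$ the preimage $f^{-1}[x+A+y]$ is a meager subset of $\{0,1\}^\omega$. Then there is a linearly independent subset $P\subseteq\mathbb R^\omega$ which is a $G_\delta$-set in $\mathbb R^\omega$, is Polish in the subspace topology, is homeomorphic to $\omega^\omega$, and has the following two properties: (1) no family $\mathcal H$ of closed Haar-meager subsets of $\mathbb R^\omega$ with $|\mathcal H|<\mathrm{cov}(\mathcal M)$ covers $P$, that is, $P\not\subseteq\bigcup\mathcal H$ for every such $\mathcal H$; (2) the linear hull of $P$ over $\mathbb R$ is a meager Borel subset (hence a meager Borel linear subspace) of $\mathbb R^\omega$. -/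

import Mathlib

open scoped Cardinal MeasureTheory

/-- `cov(M)`: the smallest cardinality of a cover of the Baire space `ω^ω` by nowhere dense
subsets. -/
noncomputable def covMeager : Cardinal.{0} :=
  sInf {κ : Cardinal.{0} | ∃ 𝓕 : Set (Set (ℕ → ℕ)),
    (∀ A ∈ 𝓕, IsNowhereDense A) ∧ ⋃₀ 𝓕 = Set.univ ∧ #𝓕 = κ}

/-- A Borel subset `A` of a topological group `X` (written additively) is Haar-meager if there is a
continuous map `f : 2^ω → X` such that `f⁻¹[x + A + y]` is meager in the Cantor cube `2^ω` for all
`x, y ∈ X`. -/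
def IsHaarMeager {X : Type*} [AddGroup X] [TopologicalSpace X] (A : Set X) : Prop :=
  MeasurableSet[borel X] A ∧
    ∃ f : (ℕ → Bool) → X, Continuous f ∧
      ∀ x y : X, IsMeagre (f ⁻¹' ((fun a => x + a + y) '' A))

/-!
The set `P` is the range of an explicit embedding `BlockCode.point` of the Baire space `ω^ω` into
`ℝ^ω`. The sequence `β` builds its point in stages. Stage `j` reads `β j`, opens a finite block of
new coordinates of prescribed length, and corrects every older coordinate by at most
`2 ^ (-(j + 1))`. A new coordinate `n` is placed in an interval of freely chosen radius `N` whose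
centre `growth k` has as its index `k` a code of `n`, `N` and `β 0, …, β (j - 1)`. Since `growth`
increases very fast, such intervals are disjoint and far apart even after all later corrections.

* A coordinate opened by stage `j` lets one read off `β 0, …, β (j - 1)` continuously, so `point`
  is an embedding (`isEmbedding_point`). Its range is Polish, hence `Gδ`
  (`Topology.IsEmbedding.isGδ_range`).
* For finitely many distinct sequences the indices `k` at the coordinate `n` are distinct for all
  large `n`. The largest one dominates, so every nontrivial linear combination of points of `P` has
  coordinates bounded away from `0` from some coordinate on (`eventually_le_abs_sum`). Hence `P` is
  linearly independent, and its linear hull is meager (`isMeagre_span_point`).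
* The linear hull is Borel by the Lusin-Souslin theorem
  (`measurableSet_span_of_linearIndependent`).
* Let a closed set `H` contain the points of all extensions of `β 0, …, β (j - 1)`, and let `f` be
  continuous on a compact space. The radii and the length of the block opened by stage `j` are
  free, and the older coordinates fill small intervals densely, so `H` contains a translate of the
  image under `f` of a nonempty open set (`exists_isOpen_translate_mem`). By the Baire category
  theorem in the Cantor cube, `H` is not Haar-meager. Therefore closed Haar-meager sets have nowhere
  dense preimages under `point`, and fewer than `cov(M)` of them cannot cover `P`.
-/

open Filter Topology Set

/-! ### Polish subspaces and linear hulls of Borel sets -/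

/-- A Polish subspace of a metrizable space is `Gδ`: the points `y` of the closure of the range for
which the trace of the neighbourhoods of `y` on the source is a Cauchy filter form a `Gδ` set, and
completeness of the source puts them into the range. -/
theorem Topology.IsEmbedding.isGδ_range {E F : Type*} [TopologicalSpace E] [PolishSpace E]
    [TopologicalSpace F] [TopologicalSpace.MetrizableSpace F] {e : E → F} (he : IsEmbedding e) :
    IsGδ (range e) := by
  let := TopologicalSpace.upgradeIsCompletelyMetrizable E
  let := TopologicalSpace.metrizableSpaceMetric F
  set O : ℕ → Set F := fun n =>
    ⋃₀ {U | IsOpen U ∧ ∀ x ∈ e ⁻¹' U, ∀ y ∈ e ⁻¹' U, dist x y < 1 / ((n : ℝ) + 1)} with hO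
  have hOo : ∀ n, IsOpen (O n) := fun n => isOpen_sUnion fun U hU => hU.1
  have key : range e = closure (range e) ∩ ⋂ n, O n := by
    apply Subset.antisymm
    · rintro _ ⟨x, rfl⟩
      refine ⟨subset_closure (mem_range_self x), mem_iInter.2 fun n => ?_⟩
      obtain ⟨U, hU, hUe⟩ := he.isInducing.isOpen_iff.1
        (Metric.isOpen_ball (x := x) (ε := 1 / ((n : ℝ) + 1) / 2))
      refine mem_sUnion.2 ⟨U, ⟨hU, ?_⟩, ?_⟩
      · rw [hUe]
        intro a ha b hb
        calc dist a b ≤ dist a x + dist b x := dist_triangle_right a b x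
          _ < 1 / ((n : ℝ) + 1) / 2 + 1 / ((n : ℝ) + 1) / 2 := add_lt_add ha hb
          _ = _ := by ring
      · change x ∈ e ⁻¹' U
        rw [hUe]
        exact Metric.mem_ball_self (by positivity)
    · rintro y ⟨hy, hyO⟩
      have hne : (comap e (𝓝 y)).NeBot := comap_neBot_iff.2 fun t ht => by
        obtain ⟨_, hz, x, rfl⟩ := mem_closure_iff_nhds.1 hy t ht
        exact ⟨x, hz⟩
      have hc : Cauchy (comap e (𝓝 y)) := by
        refine Metric.cauchy_iff.2 ⟨hne, fun ε hε => ?_⟩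
        obtain ⟨n, hn⟩ := exists_nat_one_div_lt hε
        obtain ⟨U, ⟨hU, hd⟩, hyU⟩ := mem_sUnion.1 (mem_iInter.1 hyO n)
        exact ⟨e ⁻¹' U, preimage_mem_comap (hU.mem_nhds hyU),
          fun a ha b hb => (hd a ha b hb).trans hn⟩
      obtain ⟨x, hx⟩ := CompleteSpace.complete hc
      have h1 : Tendsto e (comap e (𝓝 y)) (𝓝 (e x)) := (he.continuous.tendsto x).mono_left hx
      exact ⟨x, tendsto_nhds_unique h1 tendsto_comap⟩
  rw [key]
  exact isClosed_closure.isGδ.inter (IsGδ.iInter fun n => (hOo n).isGδ)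

/-- The linear hull of a linearly independent Borel set is Borel. A nonzero vector of the hull has a
unique representation `∑ aᵢ pᵢ` with nonzero coefficients and with `pᵢ ∈ P` listed increasingly for
a Borel linear order, so the hull is a countable union of continuous injective images of Borel sets,
and the Lusin-Souslin theorem applies. -/
theorem measurableSet_span_of_linearIndependent {E : Type*} [AddCommGroup E] [Module ℝ E]
    [TopologicalSpace E] [IsTopologicalAddGroup E] [ContinuousSMul ℝ E] [PolishSpace E]
    [MeasurableSpace E] [BorelSpace E] {P : Set E} (hP : MeasurableSet P)
    (hli : LinearIndependent ℝ (Subtype.val : P → E)) :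
    MeasurableSet (Submodule.span ℝ P : Set E) := by
  obtain ⟨φ, hφ⟩ := MeasureTheory.exists_measurableEmbedding_real E
  set S : (r : ℕ) → Set ((Fin r → ℝ) × (Fin r → E)) := fun r =>
    {q | (∀ i, q.1 i ≠ 0) ∧ (∀ i, q.2 i ∈ P) ∧ ∀ i j, i < j → φ (q.2 i) < φ (q.2 j)} with hS
  set g : (r : ℕ) → ((Fin r → ℝ) × (Fin r → E)) → E := fun r q => ∑ i, q.1 i • q.2 i with hg
  have hmeas : ∀ r, MeasurableSet (S r) := by
    intro r
    have h1 : ∀ i : Fin r, Measurable fun q : (Fin r → ℝ) × (Fin r → E) => q.1 i :=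
      fun i => (measurable_pi_apply i).comp measurable_fst
    have h2 : ∀ i : Fin r, Measurable fun q : (Fin r → ℝ) × (Fin r → E) => q.2 i :=
      fun i => (measurable_pi_apply i).comp measurable_snd
    have hSr : S r = (⋂ i, {q | q.1 i ≠ 0}) ∩ ((⋂ i, {q | q.2 i ∈ P}) ∩
        ⋂ i, ⋂ j, ⋂ _ : i < j, {q | φ (q.2 i) < φ (q.2 j)}) := by
      ext q
      simp [hS]
    rw [hSr]
    exact (MeasurableSet.iInter fun i =>
        (measurableSet_singleton (0 : ℝ)).compl.preimage (h1 i)).inter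
      ((MeasurableSet.iInter fun i => hP.preimage (h2 i)).inter
      (MeasurableSet.iInter fun i => MeasurableSet.iInter fun j => MeasurableSet.iInter fun _ =>
          measurableSet_lt (hφ.measurable.comp (h2 i)) (hφ.measurable.comp (h2 j))))
  have hcont : ∀ r, Continuous (g r) := by
    intro r
    fun_prop
  have hinj : ∀ r, InjOn (g r) (S r) := by
    rintro r ⟨a, p⟩ ⟨ha, hp, hlt⟩ ⟨a', p'⟩ ⟨ha', hp', hlt'⟩ heq
    simp only at ha hp hlt ha' hp' hlt'
    -- Both representations define finitely supported functions on `P` with the same linear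
    -- combination, so these functions are equal; their supports are the ranges of `p` and `p'`.
    have aux : ∀ (a : Fin r → ℝ) (p : Fin r → E) (hp : ∀ i, p i ∈ P),
        Finsupp.linearCombination ℝ (Subtype.val : P → E)
          (Finsupp.mapDomain (fun i => (⟨p i, hp i⟩ : P)) (Finsupp.equivFunOnFinite.symm a))
          = g r (a, p) := by
      intro a p hp
      rw [Finsupp.linearCombination_mapDomain, Finsupp.linearCombination_apply,
        Finsupp.sum_fintype _ _ (by simp)]
      rfl
    have hl := hli (((aux a p hp).trans heq).trans (aux a' p' hp').symm)
    have hm : StrictMono fun i => φ (p i) := fun i j h => hlt i j h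
    have hm' : StrictMono fun i => φ (p' i) := fun i j h => hlt' i j h
    have hi : Function.Injective fun i => (⟨p i, hp i⟩ : P) := fun i j h =>
      hm.injective (by simpa using congrArg φ (Subtype.ext_iff.1 h))
    have hi' : Function.Injective fun i => (⟨p' i, hp' i⟩ : P) := fun i j h =>
      hm'.injective (by simpa using congrArg φ (Subtype.ext_iff.1 h))
    have hval : ∀ i, Finsupp.mapDomain (fun i => (⟨p i, hp i⟩ : P))
        (Finsupp.equivFunOnFinite.symm a) ⟨p i, hp i⟩ = a i := fun i =>
      Finsupp.mapDomain_apply hi _ i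
    have hval' : ∀ i, Finsupp.mapDomain (fun i => (⟨p' i, hp' i⟩ : P))
        (Finsupp.equivFunOnFinite.symm a') ⟨p' i, hp' i⟩ = a' i := fun i =>
      Finsupp.mapDomain_apply hi' _ i
    have hr : range (fun i => (⟨p i, hp i⟩ : P)) = range (fun i => (⟨p' i, hp' i⟩ : P)) := by
      apply Subset.antisymm
      · rintro _ ⟨i, rfl⟩
        by_contra hcon
        exact ha i (by rw [← hval i, hl]; exact Finsupp.mapDomain_of_notMem_range _ _ hcon)
      · rintro _ ⟨i, rfl⟩
        by_contra hcon
        exact ha' i (by rw [← hval' i, ← hl]; exact Finsupp.mapDomain_of_notMem_range _ _ hcon)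
    have hr' : range (fun i => φ (p i)) = range (fun i => φ (p' i)) := by
      have h := congrArg (fun s => (fun x : P => φ x) '' s) hr
      simp only [← range_comp] at h
      exact h
    -- A strictly increasing enumeration is determined by its range.
    have hpp : p = p' := by
      funext i
      exact hφ.injective (congrFun ((hm.range_inj hm').1 hr') i)
    subst hpp
    have haa : a = a' := by
      funext i
      rw [← hval i, ← hval' i, hl]
    rw [haa]
  have hspan : (Submodule.span ℝ P : Set E) = ⋃ r, g r '' S r := by
    apply Subset.antisymm
    · intro x hx
      obtain ⟨l, rfl⟩ := (Finsupp.mem_span_iff_linearCombination ℝ P x).1 hx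
      let : LinearOrder P := LinearOrder.lift' (fun x : P => φ x)
        (hφ.injective.comp Subtype.val_injective)
      refine mem_iUnion.2 ⟨l.support.card,
        ⟨fun i => l (l.support.orderEmbOfFin rfl i), fun i => l.support.orderEmbOfFin rfl i⟩,
        ⟨fun i => ?_, fun i => Subtype.coe_prop _, fun i j hij => ?_⟩, ?_⟩
      · exact Finsupp.mem_support_iff.1 (Finset.orderEmbOfFin_mem _ _ i)
      · exact (l.support.orderEmbOfFin rfl).strictMono hij
      · rw [Finsupp.linearCombination_apply, Finsupp.sum]
        conv_rhs => rw [← Finset.map_orderEmbOfFin_univ l.support rfl]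
        rw [Finset.sum_map]
        rfl
    · refine iUnion_subset fun r => ?_
      rintro _ ⟨⟨a, p⟩, ⟨-, hp, -⟩, rfl⟩
      exact Submodule.sum_mem _ fun i _ => Submodule.smul_mem _ _ (Submodule.subset_span (hp i))
  rw [hspan]
  exact MeasurableSet.iUnion fun r =>
    (hmeas r).image_of_continuousOn_injOn (hcont r).continuousOn (hinj r)

namespace BlockCode

/-! ### A rapidly growing sequence and a dense sequence in `[-1, 1]` -/

/-- A sequence of positive reals growing so fast that `4 * (l + 1) * growth k ≤ growth l`
whenever `k < l`. -/
noncomputable def growth (k : ℕ) : ℝ := 4 ^ (k + 1) * (k + 1).factorial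

lemma growth_succ (k : ℕ) : growth (k + 1) = 4 * ((k : ℝ) + 2) * growth k := by
  unfold growth
  rw [Nat.factorial_succ (k + 1)]
  push_cast
  ring

lemma growth_pos (k : ℕ) : 0 < growth k := by
  unfold growth
  positivity

lemma le_growth (k : ℕ) : 4 * ((k : ℝ) + 1) ≤ growth k := by
  induction k with
  | zero => norm_num [growth]
  | succ k ih =>
    have hk : (0 : ℝ) ≤ k := k.cast_nonneg
    rw [growth_succ]
    push_cast
    nlinarith

lemma growth_mono : Monotone growth := by
  refine monotone_nat_of_le_succ fun k => ?_
  have hk : (0 : ℝ) ≤ k := k.cast_nonneg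
  have := growth_pos k
  rw [growth_succ]
  nlinarith

lemma growth_mul_le {k l : ℕ} (h : k < l) : 4 * ((l : ℝ) + 1) * growth k ≤ growth l := by
  obtain ⟨l, rfl⟩ : ∃ l', l = l' + 1 := ⟨l - 1, by omega⟩
  have hk : growth k ≤ growth l := growth_mono (by omega)
  have hl : (0 : ℝ) ≤ l := l.cast_nonneg
  rw [growth_succ]
  push_cast
  have : 4 * ((l : ℝ) + 1 + 1) = 4 * ((l : ℝ) + 2) := by ring
  rw [this]
  gcongr

/-- A sequence in `[-1, 1]` with dense range and `rho 0 = 0`: the later terms enumerate the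
rationals, clipped to `[-1, 1]`. The zero term serves for making no correction. -/
noncomputable def rho (e : ℕ) : ℝ :=
  if e = 0 then 0 else max (-1) (min 1 ((Denumerable.ofNat ℚ (e - 1) : ℚ) : ℝ))

@[simp] lemma rho_zero : rho 0 = 0 := by simp [rho]

lemma abs_rho_le (e : ℕ) : |rho e| ≤ 1 := by
  unfold rho
  split_ifs
  · simp
  · exact abs_le.2 ⟨le_max_left _ _, max_le (by norm_num) (min_le_left _ _)⟩

/-- The multiples `c * rho e` are dense in `[-c, c]`. -/
lemma exists_mul_rho_near {c x ε : ℝ} (hx : |x| ≤ c) (hε : 0 < ε) :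
    ∃ e, |c * rho e - x| < ε := by
  have hc0 : 0 ≤ c := (abs_nonneg x).trans hx
  rcases hc0.eq_or_lt with rfl | hc
  · exact ⟨0, by simpa [abs_nonpos_iff.1 hx] using hε⟩
  obtain ⟨q, hq1, hq2⟩ := exists_rat_btwn (show x / c - ε / c < x / c + ε / c by
    have := div_pos hε hc
    linarith)
  obtain ⟨p, rfl⟩ : ∃ p, Denumerable.ofNat ℚ p = q := (Denumerable.eqv ℚ).symm.surjective q
  refine ⟨p + 1, ?_⟩
  have hxc := abs_le.1 hx
  have h1 : x / c ≤ 1 := (div_le_one hc).2 hxc.2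
  have h2 : -1 ≤ x / c := by
    rw [le_div_iff₀ hc]
    linarith
  have hεc := div_pos hε hc
  have hr : |rho (p + 1) - x / c| < ε / c := by
    simp only [rho, Nat.succ_ne_zero, if_false, Nat.add_sub_cancel]
    rw [abs_lt]
    constructor
    · have : x / c - ε / c < max (-1) (min 1 (Denumerable.ofNat ℚ p : ℝ)) :=
        lt_max_of_lt_right (lt_min (by linarith) hq1)
      linarith
    · have : max (-1) (min 1 (Denumerable.ofNat ℚ p : ℝ)) < x / c + ε / c :=
        max_lt (by linarith) ((min_le_right _ _).trans_lt hq2)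
      linarith
  have : c * rho (p + 1) - x = c * (rho (p + 1) - x / c) := by
    field_simp
  rw [this, abs_mul, abs_of_pos hc]
  calc c * _ < c * (ε / c) := by gcongr
    _ = ε := by field_simp

/-! ### Blocks, codes and stages -/

/-- The number of new coordinates, minus one, opened by a stage whose datum is `a`. -/
def blockLen (a : ℕ) : ℕ := a.unpair.1

/-- The `n`-th entry of the finite sequence coded by `a`, read as `0` beyond its length. -/
def entry (a n : ℕ) : ℕ := (Denumerable.ofNat (List ℕ) a.unpair.2).getD n 0

lemma exists_block (M L : ℕ) (e : ℕ → ℕ) :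
    ∃ a, blockLen a = M ∧ ∀ n < L, entry a n = e n := by
  refine ⟨Nat.pair M (Encodable.encode ((List.range L).map e)), by simp [blockLen], ?_⟩
  intro n hn
  simp [entry, List.getD_eq_getElem?_getD, hn]

lemma exists_zero_block : ∃ a, ∀ n, entry a n = 0 :=
  ⟨Nat.pair 0 (Encodable.encode ([] : List ℕ)), fun n => by
    simp only [entry, Nat.unpair_pair, Denumerable.ofNat_encode]
    rfl⟩

/-- A code of the finite sequence `β 0, …, β (j - 1)`. -/
def code (β : ℕ → ℕ) : ℕ → ℕ
  | 0 => 0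
  | j + 1 => Nat.pair (code β j) (β j) + 1

/-- The first coordinate opened by stage `j`: stage `j` opens the coordinates in
`[bdry β j, bdry β (j + 1))`. -/
def bdry (β : ℕ → ℕ) : ℕ → ℕ
  | 0 => 0
  | j + 1 => bdry β j + blockLen (β j) + 1

/-- The stage that opens the coordinate `n`. -/
def stage (β : ℕ → ℕ) (n : ℕ) : ℕ := Nat.findGreatest (fun j => bdry β j ≤ n) n

variable {β γ : ℕ → ℕ} {i j n : ℕ}

lemma code_congr (h : ∀ i < j, γ i = β i) : code γ j = code β j := by
  induction j with
  | zero => rfl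
  | succ j ih => rw [code, code, ih fun i hi => h i (by omega), h j (by omega)]

lemma bdry_congr (h : ∀ i < j, γ i = β i) : bdry γ j = bdry β j := by
  induction j with
  | zero => rfl
  | succ j ih => rw [bdry, bdry, ih fun i hi => h i (by omega), h j (by omega)]

lemma code_inj (h : code γ i = code β j) : i = j ∧ ∀ k < j, γ k = β k := by
  induction j generalizing i with
  | zero =>
    cases i with
    | zero => exact ⟨rfl, by simp⟩
    | succ i => simp [code] at h
  | succ j ih =>
    cases i with
    | zero => simp [code] at h
    | succ i =>
      simp only [code, Nat.add_right_cancel_iff, Nat.pair_eq_pair] at h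
      obtain ⟨rfl, hk⟩ := ih h.1
      refine ⟨rfl, fun k hk' => ?_⟩
      rcases Nat.lt_succ_iff_lt_or_eq.1 hk' with h' | rfl
      exacts [hk k h', h.2]

lemma bdry_strictMono (β : ℕ → ℕ) : StrictMono (bdry β) :=
  strictMono_nat_of_lt_succ fun j => by
    rw [bdry]
    omega

lemma bdry_stage_le (β : ℕ → ℕ) (n : ℕ) : bdry β (stage β n) ≤ n :=
  Nat.findGreatest_spec (P := fun j => bdry β j ≤ n) (Nat.zero_le n) (Nat.zero_le n)

lemma lt_bdry_stage_succ (β : ℕ → ℕ) (n : ℕ) : n < bdry β (stage β n + 1) := by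
  by_contra! h
  have h1 : stage β n + 1 ≤ n := ((bdry_strictMono β).le_apply).trans h
  exact Nat.findGreatest_is_greatest (P := fun j => bdry β j ≤ n) (Nat.lt_succ_self _) h1 h

lemma stage_eq (h1 : bdry β j ≤ n) (h2 : n < bdry β (j + 1)) : stage β n = j := by
  have h3 := (bdry_strictMono β).lt_iff_lt.1 ((bdry_stage_le β n).trans_lt h2)
  have h4 := (bdry_strictMono β).lt_iff_lt.1 (h1.trans_lt (lt_bdry_stage_succ β n))
  omega

lemma stage_lt (h : n < bdry β j) : stage β n < j :=
  (bdry_strictMono β).lt_iff_lt.1 ((bdry_stage_le β n).trans_lt h)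

lemma lt_stage (h : bdry β (j + 1) ≤ n) : j < stage β n := by
  have := (bdry_strictMono β).lt_iff_lt.1 (h.trans_lt (lt_bdry_stage_succ β n))
  omega

lemma stage_congr (h : ∀ i < j, γ i = β i) (hn : n < bdry β j) : stage γ n = stage β n := by
  have hs := stage_lt hn
  refine stage_eq ?_ ?_
  · rw [bdry_congr fun i hi => h i (by omega)]
    exact bdry_stage_le β n
  · rw [bdry_congr fun i hi => h i (by omega)]
    exact lt_bdry_stage_succ β n

/-! ### The embedding of the Baire space -/

/-- The index of the interval that contains the coordinate `n` of the point coded by `β`; it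
records `n`, the data of all stages before the one that opens `n`, and the radius chosen there. -/
def label (β : ℕ → ℕ) (n : ℕ) : ℕ :=
  Nat.pair n (Nat.pair (code β (stage β n)) (entry (β (stage β n)) n).unpair.1)

/-- The value given to the coordinate `n` by the stage that opens it. -/
noncomputable def coarse (β : ℕ → ℕ) (n : ℕ) : ℝ :=
  growth (label β n) +
    (entry (β (stage β n)) n).unpair.1 * rho (entry (β (stage β n)) n).unpair.2

/-- The correction made at stage `j` to a coordinate `n` that an earlier stage has opened. -/
noncomputable def fine (β : ℕ → ℕ) (j n : ℕ) : ℝ :=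
  if n < bdry β j then (1 / 2) ^ (j + 1) * rho (entry (β j) n) else 0

/-- The point of `ℝ^ω` coded by `β`. -/
noncomputable def point (β : ℕ → ℕ) (n : ℕ) : ℝ := coarse β n + ∑' j, fine β j n

lemma coarse_congr (h : ∀ i < j, γ i = β i) (hn : n < bdry β j) : coarse γ n = coarse β n := by
  have hs := stage_lt hn
  rw [coarse, coarse, label, label, stage_congr h hn, h _ hs,
    code_congr fun i hi => h i (hi.trans hs)]

lemma fine_congr (h : ∀ i < j + 1, γ i = β i) : fine γ j n = fine β j n := by
  rw [fine, fine, bdry_congr fun i hi => h i (by omega), h j (by omega)]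

lemma abs_fine_le (β : ℕ → ℕ) (j n : ℕ) : |fine β j n| ≤ (1 / 2) ^ (j + 1) := by
  unfold fine
  split_ifs
  · rw [abs_mul, abs_of_pos (by positivity)]
    exact mul_le_of_le_one_right (by positivity) (abs_rho_le _)
  · simp only [abs_zero]
    positivity

lemma hasSum_half_pow : HasSum (fun j : ℕ => (1 / 2 : ℝ) ^ (j + 1)) 1 := by
  have := hasSum_geometric_two.mul_right (1 / 2 : ℝ)
  simpa [pow_succ] using this

lemma abs_tsum_fine_le (β : ℕ → ℕ) (n : ℕ) : |∑' j, fine β j n| ≤ 1 :=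
  tsum_of_norm_bounded (f := fun j => fine β j n) hasSum_half_pow fun j => abs_fine_le β j n

lemma le_label (β : ℕ → ℕ) (n : ℕ) : n ≤ label β n := Nat.left_le_pair _ _

lemma abs_point_sub_le (β : ℕ → ℕ) (n : ℕ) :
    |point β n - growth (label β n)| ≤ label β n + 1 := by
  set N := (entry (β (stage β n)) n).unpair.1 with hN
  set r := rho (entry (β (stage β n)) n).unpair.2 with hr
  have h1 : N ≤ label β n := (Nat.right_le_pair _ _).trans (Nat.right_le_pair _ _)
  have h2 : |(N : ℝ) * r| ≤ label β n := by
    rw [abs_mul, Nat.abs_cast]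
    calc (N : ℝ) * |r| ≤ N * 1 := by
          gcongr
          exact abs_rho_le _
      _ ≤ label β n := by
          rw [mul_one]
          exact_mod_cast h1
  have h3 : point β n - growth (label β n) = N * r + ∑' j, fine β j n := by
    rw [point, coarse]
    ring
  rw [h3]
  exact (abs_add_le _ _).trans (add_le_add h2 (abs_tsum_fine_le β n))

lemma growth_half_lt_point (β : ℕ → ℕ) (n : ℕ) : growth (label β n) / 2 < point β n := by
  have h1 := abs_le.1 (abs_point_sub_le β n)
  have h2 := le_growth (label β n)
  have h3 := growth_pos (label β n)
  linarith

lemma point_lt_two_growth (β : ℕ → ℕ) (n : ℕ) : point β n < 2 * growth (label β n) := by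
  have h1 := abs_le.1 (abs_point_sub_le β n)
  have h2 := le_growth (label β n)
  have h3 := growth_pos (label β n)
  linarith

/-- The intervals `(growth k / 2, 2 * growth k)` are pairwise disjoint. -/
lemma eq_of_mem_growth_interval {k l : ℕ} {x : ℝ} (hk : growth k / 2 < x) (hk' : x < 2 * growth k)
    (hl : growth l / 2 < x) (hl' : x < 2 * growth l) : k = l := by
  have key : ∀ {k l : ℕ}, k < l → 4 * growth k ≤ growth l := by
    intro k l h
    have h1 := growth_mul_le h
    have h2 := growth_pos k
    have h3 : (0 : ℝ) ≤ l := l.cast_nonneg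
    nlinarith
  rcases lt_trichotomy k l with h | h | h
  · have := key h
    linarith
  · exact h
  · have := key h
    linarith

lemma eventually_agree (β : ℕ → ℕ) (j : ℕ) : ∀ᶠ γ in 𝓝 β, ∀ i < j, γ i = β i := by
  refine (eventually_all_finite (finite_lt_nat j)).2 fun i _ => ?_
  have : ContinuousAt (fun γ : ℕ → ℕ => γ i) β := (continuous_apply i).continuousAt
  simpa [ContinuousAt, nhds_discrete] using this

lemma continuous_point : Continuous point := by
  refine continuous_pi fun n => Continuous.add ?_ (continuous_tsum (fun j => ?_)
    hasSum_half_pow.summable fun j β => abs_fine_le β j n)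
  · refine continuous_iff_continuousAt.2 fun β => ?_
    refine continuousAt_const (y := coarse β n) |>.congr ?_
    filter_upwards [eventually_agree β (n + 1)] with γ hγ
    exact (coarse_congr hγ ((Nat.lt_succ_self n).trans_le (bdry_strictMono β).le_apply)).symm
  · refine continuous_iff_continuousAt.2 fun β => ?_
    refine continuousAt_const (y := fine β j n) |>.congr ?_
    filter_upwards [eventually_agree β (j + 1)] with γ hγ
    exact (fine_congr hγ).symm

/-- The first coordinate opened by stage `j` determines, by the interval in which it lies, the data
of all earlier stages. -/
lemma isEmbedding_point : IsEmbedding point := by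
  have hind : IsInducing point := by
    refine isInducing_iff_nhds.2 fun β => le_antisymm
      continuous_point.continuousAt.tendsto.le_comap ?_
    change Tendsto id (comap point (𝓝 (point β))) (𝓝 β)
    refine tendsto_pi_nhds.2 fun i => ?_
    rw [nhds_discrete ℕ, tendsto_pure]
    -- The coordinate `n` is opened by stage `i + 1`, so its label records `β 0, …, β i`.
    set n := bdry β (i + 1) with hn
    have hs : stage β n = i + 1 := stage_eq le_rfl (bdry_strictMono β (Nat.lt_succ_self _))
    have hev : ∀ᶠ y in 𝓝 (point β), y n ∈ Ioo (growth (label β n) / 2) (2 * growth (label β n)) :=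
      (continuous_apply n).continuousAt.eventually_mem
        (Ioo_mem_nhds (growth_half_lt_point β n) (point_lt_two_growth β n))
    filter_upwards [hev.comap point] with γ hγ
    have hl := eq_of_mem_growth_interval (growth_half_lt_point γ n) (point_lt_two_growth γ n)
      hγ.1 hγ.2
    simp only [label, Nat.pair_eq_pair, true_and] at hl
    exact (code_inj hl.1).2 i (by omega)
  exact ⟨hind, hind.injective⟩

/-! ### Linear combinations of coded points -/

/-- Distinct points lie in distinct intervals at all large coordinates, because the codes of
different lengths or of different sequences are different. -/
lemma eventually_label_ne (h : β ≠ γ) : ∀ᶠ n in atTop, label β n ≠ label γ n := by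
  obtain ⟨i, hi⟩ := Function.ne_iff.1 h
  filter_upwards [eventually_ge_atTop (bdry γ (i + 1))] with n hn heq
  simp only [label, Nat.pair_eq_pair, true_and] at heq
  exact hi ((code_inj heq.1).2 i (lt_stage hn))

/-- At a large coordinate the point with the largest label dominates all others. -/
lemma eventually_le_abs_sum {s : Finset (ℕ → ℕ)} (hs : s.Nonempty) {a : (ℕ → ℕ) → ℝ}
    (ha : ∀ β ∈ s, a β ≠ 0) : ∀ᶠ n in atTop, 1 ≤ |∑ β ∈ s, a β * point β n| := by
  classical
  obtain ⟨μ, hμs, hμ⟩ := s.exists_min_image (fun β => |a β|) hs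
  set m := |a μ| with hm
  have hm0 : 0 < m := abs_pos.2 (ha μ hμs)
  set A := ∑ β ∈ s, |a β| with hA
  have hne : ∀ᶠ n in atTop, ∀ β ∈ s, ∀ γ ∈ s, β ≠ γ → label β n ≠ label γ n := by
    refine (Finset.eventually_all s).2 fun β _ => (Finset.eventually_all s).2 fun γ _ => ?_
    by_cases h : β = γ
    · simp [h]
    · exact (eventually_label_ne h).mono fun n hn _ => hn
  have h1 : ∀ᶠ n : ℕ in atTop, 2 * A / m ≤ n :=
    tendsto_natCast_atTop_atTop.eventually_ge_atTop _
  have h2 : ∀ᶠ n : ℕ in atTop, 1 / m ≤ n :=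
    tendsto_natCast_atTop_atTop.eventually_ge_atTop _
  filter_upwards [hne, h1, h2] with n hn hn1 hn2
  obtain ⟨τ, hτs, hτ⟩ := s.exists_max_image (fun β => label β n) hs
  set k := label τ n with hk
  have hnk : (n : ℝ) ≤ k := by exact_mod_cast le_label τ n
  have hT := le_growth k
  -- The labels of the other points are smaller than `k`, so their coordinates are smaller than
  -- `growth k` by a factor of order `k + 1`.
  have hrest : |∑ β ∈ s.erase τ, a β * point β n| ≤ A * (growth k / (2 * ((k : ℝ) + 1))) := by
    calc |∑ β ∈ s.erase τ, a β * point β n| ≤ ∑ β ∈ s.erase τ, |a β * point β n| :=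
          Finset.abs_sum_le_sum_abs _ _
      _ ≤ ∑ β ∈ s.erase τ, |a β| * (growth k / (2 * ((k : ℝ) + 1))) := by
          refine Finset.sum_le_sum fun β hβ => ?_
          obtain ⟨hβτ, hβs⟩ := Finset.mem_erase.1 hβ
          rw [abs_mul]
          refine mul_le_mul_of_nonneg_left ?_ (abs_nonneg _)
          have hlt : label β n < k := lt_of_le_of_ne (hτ β hβs) (hn β hβs τ hτs hβτ)
          have h3 := growth_mul_le hlt
          have h4 := growth_half_lt_point β n
          have h5 := point_lt_two_growth β n
          have h6 := growth_pos (label β n)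
          rw [abs_of_pos (by linarith), le_div_iff₀ (by positivity)]
          have hk0 : (0 : ℝ) < (k : ℝ) + 1 := by positivity
          nlinarith
      _ = (∑ β ∈ s.erase τ, |a β|) * (growth k / (2 * ((k : ℝ) + 1))) :=
          (Finset.sum_mul _ _ _).symm
      _ ≤ A * (growth k / (2 * ((k : ℝ) + 1))) := by
          refine mul_le_mul_of_nonneg_right ?_ (div_nonneg (growth_pos k).le (by positivity))
          exact Finset.sum_le_sum_of_subset_of_nonneg (Finset.erase_subset _ _)
            fun _ _ _ => abs_nonneg _
  have htop : m * (growth k / 2) ≤ |a τ * point τ n| := by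
    have h4 := growth_half_lt_point τ n
    have h6 := growth_pos k
    rw [abs_mul, abs_of_pos (h4.trans' (by positivity) : 0 < point τ n)]
    exact mul_le_mul (hμ τ hτs) h4.le (by positivity) (abs_nonneg _)
  have hAk : A * (growth k / (2 * ((k : ℝ) + 1))) ≤ m * (growth k / 4) := by
    have hk0 : (0 : ℝ) < (k : ℝ) + 1 := by positivity
    have h3 : 2 * A ≤ m * (k + 1) := by
      have := (div_le_iff₀ hm0).1 (hn1.trans hnk)
      nlinarith
    have h6 := growth_pos k
    rw [mul_div_assoc', div_le_iff₀ (by positivity)]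
    nlinarith
  have hbig : 1 ≤ m * (growth k / 4) := by
    have h3 : 1 ≤ m * k := by
      have := (div_le_iff₀ hm0).1 (hn2.trans hnk)
      linarith
    nlinarith
  rw [← Finset.add_sum_erase s _ hτs]
  have h7 := abs_sub_abs_le_abs_sub (a τ * point τ n) (-∑ β ∈ s.erase τ, a β * point β n)
  rw [abs_neg, sub_neg_eq_add] at h7
  linarith

lemma linearIndependent_point : LinearIndependent ℝ point := by
  classical
  refine linearIndependent_iff'.2 fun s a hsum => ?_
  by_contra! hcon
  obtain ⟨β, hβ, hβ0⟩ := hcon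
  obtain ⟨n, hn⟩ := (eventually_le_abs_sum (s := s.filter fun β => a β ≠ 0)
    ⟨β, Finset.mem_filter.2 ⟨hβ, hβ0⟩⟩ fun β hβ => (Finset.mem_filter.1 hβ).2).exists
  have h0 : ∑ β ∈ s.filter (fun β => a β ≠ 0), a β * point β n = 0 := by
    rw [Finset.sum_filter_of_ne fun β _ h => left_ne_zero_of_mul h]
    simpa using congrFun hsum n
  rw [h0, abs_zero] at hn
  linarith

/-- The sequences with almost all terms in a proper closed subset of the line form a meager set. -/
lemma isMeagre_setOf_eventually_mem {F : Set ℝ} (hF : IsClosed F) {y : ℝ} (hy : y ∉ F) :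
    IsMeagre {x : ℕ → ℝ | ∀ᶠ n in atTop, x n ∈ F} := by
  have hU : {x : ℕ → ℝ | ∀ᶠ n in atTop, x n ∈ F} = ⋃ N : ℕ, {x | ∀ n ≥ N, x n ∈ F} := by
    ext x
    simp
  rw [hU]
  refine isMeagre_iUnion fun N => IsNowhereDense.isMeagre ?_
  have hc : IsClosed {x : ℕ → ℝ | ∀ n ≥ N, x n ∈ F} := by
    simp only [ofPred_forall]
    exact isClosed_iInter fun n => isClosed_iInter fun _ => hF.preimage (continuous_apply n)
  rw [hc.isNowhereDense_iff, eq_empty_iff_forall_notMem]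
  intro x hx
  -- Replacing the coordinates from `K` on by `y` leaves the set but changes `x` arbitrarily little.
  have hlim : Tendsto (fun (K n : ℕ) => if n < K then x n else y) atTop (𝓝 x) := by
    refine tendsto_pi_nhds.2 fun n => tendsto_const_nhds.congr' ?_
    filter_upwards [eventually_gt_atTop n] with K hK
    rw [if_pos hK]
  obtain ⟨K, hK⟩ := (hlim.eventually (isOpen_interior.mem_nhds hx)).exists
  have := interior_subset hK (max K N) (le_max_right _ _)
  rw [if_neg (by simp)] at this
  exact hy this

lemma isMeagre_span_point : IsMeagre (Submodule.span ℝ (range point) : Set (ℕ → ℝ)) := by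
  refine ((isMeagre_setOf_eventually_mem (F := {0}) isClosed_singleton (y := 1) (by simp)).union
    (isMeagre_setOf_eventually_mem (F := {t | 1 ≤ |t|}) (isClosed_le continuous_const
      continuous_abs) (y := 0) (by simp))).mono ?_
  intro x hx
  obtain ⟨c, rfl⟩ := Finsupp.mem_span_range_iff_exists_finsupp.1 hx
  rcases c.support.eq_empty_or_nonempty with h | h
  · left
    simp [Finsupp.sum, h]
  · right
    filter_upwards [eventually_le_abs_sum h fun β hβ => Finsupp.mem_support_iff.1 hβ] with n hn
    simpa [Finsupp.sum] using hn

/-! ### Translates of compact sets in the closure of a piece -/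

/-- Stage `j` can approximate any prescribed finite part of a sequence `z` that stays close to the
coordinates fixed before stage `j` and has all other coordinates in the intervals available to
stage `j`; all later corrections are set to zero. -/
lemma exists_point_near (β : ℕ → ℕ) (j : ℕ) {z : ℕ → ℝ} {N : ℕ → ℕ}
    (hold : ∀ n < bdry β j,
      |z n - (coarse β n + ∑ i ∈ Finset.range j, fine β i n)| ≤ (1 / 2) ^ (j + 1))
    (hnew : ∀ n, bdry β j ≤ n →
      |z n - growth (Nat.pair n (Nat.pair (code β j) (N n)))| ≤ N n)
    (M : ℕ) {ε : ℝ} (hε : 0 < ε) :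
    ∃ γ : ℕ → ℕ, (∀ i < j, γ i = β i) ∧ ∀ n < M, |point γ n - z n| < ε := by
  have he : ∀ n, ∃ e : ℕ,
      (n < bdry β j → |(1 / 2) ^ (j + 1) * rho e -
        (z n - (coarse β n + ∑ i ∈ Finset.range j, fine β i n))| < ε) ∧
      (bdry β j ≤ n → e.unpair.1 = N n ∧ |N n * rho e.unpair.2 -
        (z n - growth (Nat.pair n (Nat.pair (code β j) (N n))))| < ε) := by
    intro n
    rcases lt_or_ge n (bdry β j) with h | h
    · obtain ⟨e, he⟩ := exists_mul_rho_near (hold n h) hε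
      exact ⟨e, fun _ => he, fun h' => absurd h (not_lt.2 h')⟩
    · obtain ⟨e, he⟩ := exists_mul_rho_near (hnew n h) hε
      exact ⟨Nat.pair (N n) e, fun h' => absurd h' (not_lt.2 h), fun _ => by simpa using he⟩
  -- The length `M` of the new block leaves no coordinate below `M` to a later stage.
  choose e heold henew using he
  obtain ⟨a, ha, hae⟩ := exists_block M (bdry β j + M + 1) e
  obtain ⟨o, ho⟩ := exists_zero_block
  set γ : ℕ → ℕ := fun i => if i < j then β i else if i = j then a else o with hγ
  have hγβ : ∀ i < j, γ i = β i := fun i hi => if_pos hi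
  have hγj : γ j = a := by simp [hγ]
  have hγo : ∀ i, j < i → γ i = o := fun i hi => by
    simp only [hγ]
    rw [if_neg (by omega), if_neg (by omega)]
  have hb : bdry γ j = bdry β j := bdry_congr hγβ
  have hb1 : bdry γ (j + 1) = bdry β j + M + 1 := by rw [bdry, hb, hγj, ha]
  have hlate : ∀ i n, j < i → fine γ i n = 0 := fun i n hi => by simp [fine, hγo i hi, ho]
  refine ⟨γ, hγβ, fun n hn => ?_⟩
  have hent : entry a n = e n := hae n (by omega)
  have htsum : ∑' i, fine γ i n = ∑ i ∈ Finset.range (j + 1), fine γ i n :=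
    tsum_eq_sum fun i hi => hlate i n (by simpa using hi)
  rcases lt_or_ge n (bdry β j) with h | h
  · have hsum : ∑ i ∈ Finset.range j, fine γ i n = ∑ i ∈ Finset.range j, fine β i n :=
      Finset.sum_congr rfl fun i hi => fine_congr fun k hk =>
        hγβ k (by have := Finset.mem_range.1 hi; omega)
    have hfj : fine γ j n = (1 / 2) ^ (j + 1) * rho (e n) := by
      rw [fine, if_pos (by omega), hγj, hent]
    have := heold n h
    rw [point, htsum, Finset.sum_range_succ, hsum, hfj, coarse_congr hγβ h]
    convert this using 2
    ring
  · have hst : stage γ n = j := stage_eq (by omega) (by omega)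
    have hzero : ∑ i ∈ Finset.range (j + 1), fine γ i n = 0 := by
      refine Finset.sum_eq_zero fun i hi => if_neg (not_lt.2 ?_)
      have hij : i ≤ j := Nat.lt_succ_iff.1 (Finset.mem_range.1 hi)
      exact ((bdry_strictMono γ).monotone hij).trans (hb.trans_le h)
    obtain ⟨he1, he2⟩ := henew n h
    rw [point, htsum, hzero, coarse, label, hst, hγj, hent, he1, code_congr hγβ]
    convert he2 using 2
    ring

/-- A closed set containing the points coded by all extensions of a finite sequence contains a
translate of `f '' V` for some nonempty open `V`. Indeed, once `V` is so small that `f` hardly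
varies on the finitely many coordinates already opened, the remaining coordinates of `f`, being
bounded, fit into intervals available to a single further stage. -/
lemma exists_isOpen_translate_mem {K : Type*} [TopologicalSpace K] [CompactSpace K] [Nonempty K]
    {f : K → ℕ → ℝ} (hf : Continuous f) {H : Set (ℕ → ℝ)} (hH : IsClosed H) (β : ℕ → ℕ) (j : ℕ)
    (hβ : ∀ γ : ℕ → ℕ, (∀ i < j, γ i = β i) → point γ ∈ H) :
    ∃ t : ℕ → ℝ, ∃ V : Set K, IsOpen V ∧ V.Nonempty ∧ ∀ ω ∈ V, f ω + t ∈ H := by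
  obtain ⟨ω₀⟩ := ‹Nonempty K›
  have hfn : ∀ n, Continuous fun ω => f ω n := fun n => (continuous_apply n).comp hf
  have hN : ∀ n, ∃ N : ℕ, ∀ ω, |f ω n - f ω₀ n| ≤ N := by
    intro n
    obtain ⟨C, hC⟩ := isCompact_univ.exists_bound_of_continuousOn
      ((hfn n).sub continuous_const : Continuous fun ω => f ω n - f ω₀ n).continuousOn
    obtain ⟨N, hN⟩ := exists_nat_ge C
    exact ⟨N, fun ω => (hC ω (mem_univ ω)).trans hN⟩
  choose N hN using hN
  set t : ℕ → ℝ := fun n =>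
    (if n < bdry β j then coarse β n + ∑ i ∈ Finset.range j, fine β i n
      else growth (Nat.pair n (Nat.pair (code β j) (N n)))) - f ω₀ n with ht
  refine ⟨t, ⋂ n ∈ Finset.range (bdry β j), {ω | |f ω n - f ω₀ n| < (1 / 2) ^ (j + 1)},
    isOpen_biInter_finset fun n _ =>
      isOpen_lt ((hfn n).sub continuous_const).abs continuous_const,
    ⟨ω₀, by simp⟩, fun ω hω => ?_⟩
  simp only [Finset.mem_range, mem_iInter, mem_ofPred_eq] at hω
  have hnear : ∀ M : ℕ, ∃ γ : ℕ → ℕ, (∀ i < j, γ i = β i) ∧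
      ∀ n < M, |point γ n - (f ω + t) n| < 1 / ((M : ℝ) + 1) := by
    refine fun M => exists_point_near β j (N := N) (fun n hn => ?_) (fun n hn => ?_) M
      Nat.one_div_pos_of_nat
    · rw [Pi.add_apply, ht]
      simp only [if_pos hn]
      refine le_of_eq_of_le ?_ (hω n hn).le
      congr 1
      ring
    · rw [Pi.add_apply, ht]
      simp only [if_neg (not_lt.2 hn)]
      refine le_of_eq_of_le ?_ (hN n ω)
      congr 1
      ring
  choose γ hγβ hγ using hnear
  refine hH.mem_of_tendsto (f := fun M => point (γ M)) (b := atTop) ?_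
    (Eventually.of_forall fun M => hβ _ (hγβ M))
  refine tendsto_pi_nhds.2 fun n => tendsto_iff_dist_tendsto_zero.2 ?_
  refine squeeze_zero' (Eventually.of_forall fun _ => dist_nonneg) ?_
    (tendsto_one_div_add_atTop_nhds_zero_nat (𝕜 := ℝ))
  filter_upwards [eventually_gt_atTop n] with M hM
  exact (hγ M n hM).le

lemma isNowhereDense_preimage_point {H : Set (ℕ → ℝ)} (hH : IsClosed H) (hHM : IsHaarMeager H) :
    IsNowhereDense (point ⁻¹' H) := by
  rw [(hH.preimage continuous_point).isNowhereDense_iff, eq_empty_iff_forall_notMem]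
  intro β hβ
  obtain ⟨-, f, hf, hmeagre⟩ := hHM
  obtain ⟨j, hj⟩ : ∃ j, ∀ γ : ℕ → ℕ, (∀ i < j, γ i = β i) → γ ∈ point ⁻¹' H := by
    obtain ⟨I, u, hu, hsub⟩ := isOpen_pi_iff.1 isOpen_interior β hβ
    refine ⟨I.sup id + 1, fun γ hγ => interior_subset (hsub fun i hi => ?_)⟩
    rw [hγ i (Nat.lt_succ_of_le (Finset.le_sup (f := id) hi))]
    exact (hu i hi).2
  obtain ⟨t, V, hVo, hVne, hV⟩ := exists_isOpen_translate_mem hf hH β j hj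
  refine not_isMeagre_of_isOpen hVo hVne ((hmeagre 0 (-t)).mono fun ω hω => ?_)
  exact ⟨f ω + t, hV ω hω, by simp⟩

end BlockCode

/-! ### Covers by closed Haar-meager sets -/

/-- Fewer than `cov(M)` nowhere dense sets do not cover the Baire space. -/
lemma not_subset_sUnion_of_lt_covMeager {𝓕 : Set (Set (ℕ → ℕ))}
    (h𝓕 : ∀ A ∈ 𝓕, IsNowhereDense A) (hlt : #𝓕 < covMeager) : ⋃₀ 𝓕 ≠ univ := fun hU =>
  hlt.not_ge (csInf_le' ⟨𝓕, h𝓕, hU, rfl⟩)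

open BlockCode in
theorem mainTheorem2 :
    ∃ P : Set (ℕ → ℝ),
      LinearIndependent ℝ (Subtype.val : P → (ℕ → ℝ)) ∧
      IsGδ P ∧ PolishSpace P ∧ Nonempty (P ≃ₜ (ℕ → ℕ)) ∧
      (∀ 𝓗 : Set (Set (ℕ → ℝ)), (∀ H ∈ 𝓗, IsClosed H ∧ IsHaarMeager H) →
        #𝓗 < covMeager → ¬ P ⊆ ⋃₀ 𝓗) ∧
      MeasurableSet[borel (ℕ → ℝ)] (Submodule.span ℝ P : Set (ℕ → ℝ)) ∧
      IsMeagre (Submodule.span ℝ P : Set (ℕ → ℝ)) := by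
  have hli : LinearIndependent ℝ (Subtype.val : range point → (ℕ → ℝ)) :=
    (linearIndepOn_id_range_iff isEmbedding_point.injective).2 linearIndependent_point
  have hG : IsGδ (range point) := isEmbedding_point.isGδ_range
  have hhomeo : (ℕ → ℕ) ≃ₜ range point := isEmbedding_point.toHomeomorph
  refine ⟨range point, hli, hG, hhomeo.symm.isClosedEmbedding.polishSpace, ⟨hhomeo.symm⟩, ?_, ?_,
    isMeagre_span_point⟩
  · intro 𝓗 h𝓗 hlt hcov
    refine not_subset_sUnion_of_lt_covMeager (𝓕 := (point ⁻¹' ·) '' 𝓗) ?_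
      (Cardinal.mk_image_le.trans_lt hlt) (eq_univ_of_forall fun β => ?_)
    · rintro _ ⟨H, hH, rfl⟩
      exact isNowhereDense_preimage_point (h𝓗 H hH).1 (h𝓗 H hH).2
    · obtain ⟨H, hH, hβ⟩ := hcov (mem_range_self β)
      exact ⟨point ⁻¹' H, mem_image_of_mem _ hH, hβ⟩
  · have h := measurableSet_span_of_linearIndependent hG.measurableSet hli
    rwa [BorelSpace.measurable_eq (α := ℕ → ℝ)] at h
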